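/- **Algebras.** A *PSI-algebra* is a Boolean algebra $A$ with an operation $\Diamond\colon A^3\to A$ such that, for all $a,b,c,d,e,f,x\in A$: $\Diamond(0,b,c)=\Diamond(a,0,c)=\Diamond(a,b,0)=0$; $\Diamond(a\vee x,b,c)=\Diamond(a,b,c)\vee\Diamond(x,b,c)$; $\Diamond(a,b\vee x,c)=\Diamond(a,b,c)\vee\Diamond(a,x,c)$; $\Diamond(a,b,c)\vee\Diamond(a,b,x)\le\Diamond(a,b,c\vee x)$; $\Diamond(a,b,f)\le\Diamond(a,b,\neg d)\vee\Diamond(a,b,\neg e)\vee\Diamond(d,e,f)$; $\Diamond(a,b,\neg a)=0$; $a\wedge f\le\Diamond(a,a,f)$; $\Diamond(a,b,f)\le\Diamond(b,a,f)$. A Boolean homomorphism $h\colon A\to B$ between PSI-algebras is a *semi-homomorphism* if $h(\Diamond_A(a,b,c))\le\Diamond_B(h(a),h(b),h(c))$ for all $a,b,c$, a *hemi-homomorphism* if $\Diamond_B(h(a),h(b),h(c))\le h(\Diamond_A(a,b,c))$ for all $a,b,c$, and a *homomorphism* if it is both. **Spaces.** For a Boolean (compact Hausdorff totally disconnected) space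 $X$ let $\mathscr{CO}(X)$ be its Boolean algebra of clopen sets and $\mathscr{C}_0(X)$ its set of nonempty closed subsets. For triples of subsets, $\vec Y\subseteq\vec Z$ means $Y_i\subseteq Z_i$ for all $i$, and $\vec Y\cap\vec U\ne\emptyset$ means $Y_i\cap U_i\neq\emptyset$ for some $i$. For $R\subseteq X\times\mathscr{C}_0(X)^3$ put $R(x)=\{\vec Y:(x,\vec Y)\in R\}$, $R^{-1}(\vec Y)=\{x:(x,\vec Y)\in R\}$ (so $R^{-1}(\vec Y)=\emptyset$ if some $Y_i=\emptyset$), and for $\vec U\in\mathscr{CO}(X)^3$ put $L_{\vec U}=\{\vec Y\in\mathscr{C}_0(X)^3:\vec Y\cap\vec U\ne\emptyset\}$, $\Diamond_R(\vec U)=\{x:\exists\,\vec Y\in R(x),\ \vec Y\subseteq\vec U\}$ and $\Box_R(\vec U)=\{x:R(x)\subseteq L_{\vec U}\}$. A *PSI-space* is a Boolean space $X$ with $R\subseteq X\times\mathscr{C}_0(X)^3$ such that - $\Diamond_R(\vec U)\in\mathscr{CO}(X)$ for all $\vec U\in\mathscr{CO}(X)^3$; - $R(x)=\bigcap\{L_{\vec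 U}:\vec U\in\mathscr{CO}(X)^3,\ x\in\Box_R(\vec U)\}$ for all $x\in X$; - if $\vec Y\in R(x)$, then $(\{y_1\},\{y_2\},Y_3)\in R(x)$ for some $y_1\in Y_1$, $y_2\in Y_2$; - for all $Y_1,Y_2,Y_3,Z,W\in\mathscr{C}_0(X)$: $R^{-1}(Y_1,Y_2,Y_3)\subseteq R^{-1}(Y_1,Y_2,Z)\cup R^{-1}(Y_1,Y_2,W)\cup R^{-1}(\mathrm{cl}(Z^c),\mathrm{cl}(W^c),Y_3)$; if $Y_1\cap Y_3=\emptyset$ then $R^{-1}(Y_1,Y_2,Y_3)=\emptyset$; $Y_1\cap Y_2\subseteq R^{-1}(Y_1,Y_1,Y_2)$; and $R^{-1}(Y_1,Y_2,Y_3)\subseteq R^{-1}(Y_2,Y_1,Y_3)$. Let $f\colon X_1\to X_2$ be a map between PSI-spaces such that $f^{-1}[U]\in\mathscr{CO}(X_1)$ for all $U\in\mathscr{CO}(X_2)$, and write $f[\vec Y]=(f[Y_1],f[Y_2],f[Y_3])$. Then $f$ is a *semi-PSI map* if, whenever $(f(x),\vec Z)\in R_2$, there is $\vec Y\in R_1(x)$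 with $f[\vec Y]\subseteq\vec Z$; it is a *hemi-PSI map* if $(x,\vec Y)\in R_1$ implies $(f(x),f[\vec Y])\in R_2$; and it is a *PSI map* if it is both. **Theorem.** The categories of PSI-algebras with semi-homomorphisms, with hemi-homomorphisms, and with homomorphisms are dually equivalent to the categories of PSI-spaces with semi-PSI maps, with hemi-PSI maps, and with PSI maps, respectively. In each of the three cases a dual equivalence is given by the following mutually quasi-inverse contravariant functors, which are well defined. One sends a PSI-algebra $(A,\Diamond)$ to the Stone space $\mathrm{Ul}(A)$ of its ultrafilters with the relation $R_\Diamond$, where for $\vec Y\in\mathscr{C}_0(\mathrm{Ul}(A))^3$ we have $(U,\vec Y)\in R_\Diamond$ iff $\Diamond(a_1,a_2,a_3)\in U$ for all $a_1,a_2,a_3\in A$ such that, for $i=1,2,3$, $a_i$ belongs to every ultrafilter in $Y_i$; it sends a morphism $h$ to $U\mapsto h^{-1}[U]$. The other sends a PSI-space $(X,R)$ to $(\mathscr{CO}(X),\Diamond_R)$ and a map $f$ to $V\mapsto f^{-1}[V]$. -/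

import Mathlib

open CategoryTheory Opposite TopologicalSpace

universe u

namespace PSI

/-! ### Pseudo-inference algebras -/

/-- A ternary weakly normal monotonic operator on a Boolean algebra. -/
structure Is3BAMO (A : Type u) [BooleanAlgebra A] (dia : A → A → A → A) : Prop where
  bot_left : ∀ b c, dia ⊥ b c = ⊥
  bot_mid : ∀ a c, dia a ⊥ c = ⊥
  bot_right : ∀ a b, dia a b ⊥ = ⊥
  sup_left : ∀ a x b c, dia (a ⊔ x) b c = dia a b c ⊔ dia x b c
  sup_mid : ∀ a b x c, dia a (b ⊔ x) c = dia a b c ⊔ dia a x c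
  le_sup_right : ∀ a b c x, dia a b c ⊔ dia a b x ≤ dia a b (c ⊔ x)

/-- The operator `dia` makes the Boolean algebra `A` a PSI-algebra. -/
structure IsPSIAlgebra (A : Type u) [BooleanAlgebra A] (dia : A → A → A → A) : Prop
    extends Is3BAMO A dia where
  pi1 : ∀ a b d e f, dia a b f ≤ dia a b dᶜ ⊔ dia a b eᶜ ⊔ dia d e f
  pi2 : ∀ a b, dia a b aᶜ = ⊥
  pi3 : ∀ a f, a ⊓ f ≤ dia a a f
  pi4 : ∀ a b f, dia a b f ≤ dia b a f

/-- A PSI-algebra. -/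
structure Alg where
  carrier : Type u
  [boolAlg : BooleanAlgebra carrier]
  dia : carrier → carrier → carrier → carrier
  isPSI : IsPSIAlgebra carrier dia

instance : CoeSort Alg.{u} (Type u) := ⟨Alg.carrier⟩

instance (A : Alg.{u}) : BooleanAlgebra A := A.boolAlg

/-- PSI semi-homomorphisms (among the Boolean homomorphisms). -/
def IsSemiHom {A B : Alg.{u}} (h : BoundedLatticeHom A B) : Prop :=
  ∀ a b c, h (A.dia a b c) ≤ B.dia (h a) (h b) (h c)

/-- PSI hemi-homomorphisms. -/
def IsHemiHom {A B : Alg.{u}} (h : BoundedLatticeHom A B) : Prop :=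
  ∀ a b c, B.dia (h a) (h b) (h c) ≤ h (A.dia a b c)

/-- PSI homomorphisms. -/
def IsPSIHom {A B : Alg.{u}} (h : BoundedLatticeHom A B) : Prop :=
  ∀ a b c, h (A.dia a b c) = B.dia (h a) (h b) (h c)

/-! ### Pseudo-inference spaces -/

section Relation

variable {X : Type u} [TopologicalSpace X]

/-- Membership in the family of nonempty closed subsets of `X`. -/
def C0 (Y : Set X) : Prop := IsClosed Y ∧ Y.Nonempty

/-- Two triples of subsets meet if they meet in *some* coordinate. For a triple `Y` of nonempty
closed sets and a triple `U` of clopen sets this says that `Y` belongs to `L_U`. -/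
def Meets (Y₁ Y₂ Y₃ U₁ U₂ U₃ : Set X) : Prop :=
  (Y₁ ∩ U₁).Nonempty ∨ (Y₂ ∩ U₂).Nonempty ∨ (Y₃ ∩ U₃).Nonempty

/-- `◇_R(U) = {x | R(x) is not disjoint from the complement of L_{Uᶜ}}`. -/
def diaRel (R : X → Set X → Set X → Set X → Prop) (U₁ U₂ U₃ : Set X) : Set X :=
  {x | ∃ Y₁ Y₂ Y₃, R x Y₁ Y₂ Y₃ ∧ ¬ Meets Y₁ Y₂ Y₃ U₁ᶜ U₂ᶜ U₃ᶜ}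

/-- `□_R(U) = {x | R(x) ⊆ L_U}`. -/
def boxRel (R : X → Set X → Set X → Set X → Prop) (U₁ U₂ U₃ : Set X) : Set X :=
  {x | ∀ Y₁ Y₂ Y₃, R x Y₁ Y₂ Y₃ → Meets Y₁ Y₂ Y₃ U₁ U₂ U₃}

/-- `R⁻¹(Y) = {x | (x, Y) ∈ R}`. -/
def relInv (R : X → Set X → Set X → Set X → Prop) (Y₁ Y₂ Y₃ : Set X) : Set X :=
  {x | R x Y₁ Y₂ Y₃}

end Relation

/-- Descriptive PSI-frames. The relation `R ⊆ X × C₀(X)³` is given on all triples of subsets and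
required, by `rel_C0`, to hold only at triples of nonempty closed sets. -/
structure IsPSIFrame (X : Type u) [TopologicalSpace X]
    (R : X → Set X → Set X → Set X → Prop) : Prop where
  compact : CompactSpace X
  hausdorff : T2Space X
  totallyDisconnected : TotallyDisconnectedSpace X
  rel_C0 : ∀ x Y₁ Y₂ Y₃, R x Y₁ Y₂ Y₃ → C0 Y₁ ∧ C0 Y₂ ∧ C0 Y₃
  df1 : ∀ U₁ U₂ U₃ : Set X, IsClopen U₁ → IsClopen U₂ → IsClopen U₃ →
    IsClopen (diaRel R U₁ U₂ U₃)
  df2 : ∀ x Y₁ Y₂ Y₃, C0 Y₁ → C0 Y₂ → C0 Y₃ →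
    (R x Y₁ Y₂ Y₃ ↔ ∀ U₁ U₂ U₃ : Set X, IsClopen U₁ → IsClopen U₂ → IsClopen U₃ →
      x ∈ boxRel R U₁ U₂ U₃ → Meets Y₁ Y₂ Y₃ U₁ U₂ U₃)
  df3 : ∀ x Y₁ Y₂ Y₃, R x Y₁ Y₂ Y₃ → ∃ y₁ ∈ Y₁, ∃ y₂ ∈ Y₂, R x {y₁} {y₂} Y₃

/-- PSI-spaces. -/
structure IsPSISpace (X : Type u) [TopologicalSpace X]
    (R : X → Set X → Set X → Set X → Prop) : Prop extends IsPSIFrame X R where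
  pif1 : ∀ Y₁ Y₂ Y₃ Z W : Set X, C0 Y₁ → C0 Y₂ → C0 Y₃ → C0 Z → C0 W →
    relInv R Y₁ Y₂ Y₃ ⊆
      relInv R Y₁ Y₂ Z ∪ relInv R Y₁ Y₂ W ∪ relInv R (closure Zᶜ) (closure Wᶜ) Y₃
  pif2 : ∀ Y₁ Y₂ Y₃ : Set X, C0 Y₁ → C0 Y₂ → C0 Y₃ → Y₁ ∩ Y₃ = ∅ → relInv R Y₁ Y₂ Y₃ = ∅
  pif3 : ∀ Y₁ Y₂ : Set X, C0 Y₁ → C0 Y₂ → Y₁ ∩ Y₂ ⊆ relInv R Y₁ Y₁ Y₂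
  pif4 : ∀ Y₁ Y₂ Y₃ : Set X, C0 Y₁ → C0 Y₂ → C0 Y₃ → relInv R Y₁ Y₂ Y₃ ⊆ relInv R Y₂ Y₁ Y₃

/-- A PSI-space. -/
structure Space where
  carrier : Type u
  [top : TopologicalSpace carrier]
  rel : carrier → Set carrier → Set carrier → Set carrier → Prop
  isPSI : IsPSISpace carrier rel

instance : CoeSort Space.{u} (Type u) := ⟨Space.carrier⟩

instance (X : Space.{u}) : TopologicalSpace X := X.top

section Maps

variable {X₁ X₂ : Type u} [TopologicalSpace X₁] [TopologicalSpace X₂]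

/-- Preimages of clopen sets are clopen. -/
def PreservesClopen (f : X₁ → X₂) : Prop := ∀ U : Set X₂, IsClopen U → IsClopen (f ⁻¹' U)

/-- Back condition: if `(f x, Z) ∈ R₂`, then some `Y ∈ R₁(x)` satisfies `f[Y] ⊆ Z`. -/
def Back (R₁ : X₁ → Set X₁ → Set X₁ → Set X₁ → Prop) (R₂ : X₂ → Set X₂ → Set X₂ → Set X₂ → Prop)
    (f : X₁ → X₂) : Prop :=
  ∀ x Z₁ Z₂ Z₃, R₂ (f x) Z₁ Z₂ Z₃ →
    ∃ Y₁ Y₂ Y₃, R₁ x Y₁ Y₂ Y₃ ∧ f '' Y₁ ⊆ Z₁ ∧ f '' Y₂ ⊆ Z₂ ∧ f '' Y₃ ⊆ Z₃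

/-- Forth condition: if `(x, Y) ∈ R₁`, then `(f x, f[Y]) ∈ R₂`. -/
def Forth (R₁ : X₁ → Set X₁ → Set X₁ → Set X₁ → Prop) (R₂ : X₂ → Set X₂ → Set X₂ → Set X₂ → Prop)
    (f : X₁ → X₂) : Prop :=
  ∀ x Y₁ Y₂ Y₃, R₁ x Y₁ Y₂ Y₃ → R₂ (f x) (f '' Y₁) (f '' Y₂) (f '' Y₃)

/-- Semi-PSI maps (the maps dual to PSI semi-homomorphisms). -/
def IsSemiMap (R₁ : X₁ → Set X₁ → Set X₁ → Set X₁ → Prop)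
    (R₂ : X₂ → Set X₂ → Set X₂ → Set X₂ → Prop) (f : X₁ → X₂) : Prop :=
  PreservesClopen f ∧ Back R₁ R₂ f

/-- Hemi-PSI maps (the maps dual to PSI hemi-homomorphisms). -/
def IsHemiMap (R₁ : X₁ → Set X₁ → Set X₁ → Set X₁ → Prop)
    (R₂ : X₂ → Set X₂ → Set X₂ → Set X₂ → Prop) (f : X₁ → X₂) : Prop :=
  PreservesClopen f ∧ Forth R₁ R₂ f

/-- PSI maps. -/
def IsPSIMap (R₁ : X₁ → Set X₁ → Set X₁ → Set X₁ → Prop)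
    (R₂ : X₂ → Set X₂ → Set X₂ → Set X₂ → Prop) (f : X₁ → X₂) : Prop :=
  IsSemiMap R₁ R₂ f ∧ IsHemiMap R₁ R₂ f

end Maps

/-! ### The three categories on each side -/

/-- The three kinds of morphisms. -/
inductive Kind
  | semi
  | hemi
  | full

/-- The algebra morphisms of the given kind. -/
def IsAlgMor {A B : Alg.{u}} : Kind → BoundedLatticeHom A B → Prop
  | .semi => IsSemiHom
  | .hemi => IsHemiHom
  | .full => IsPSIHom

/-- The maps of the given kind. -/
def IsSpMor {X₁ X₂ : Type u} [TopologicalSpace X₁] [TopologicalSpace X₂] :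
    Kind → (X₁ → Set X₁ → Set X₁ → Set X₁ → Prop) → (X₂ → Set X₂ → Set X₂ → Set X₂ → Prop) →
      (X₁ → X₂) → Prop
  | .semi => IsSemiMap
  | .hemi => IsHemiMap
  | .full => IsPSIMap

theorem isAlgMor_id (j : Kind) (A : Alg.{u}) : IsAlgMor j (BoundedLatticeHom.id A) := by
  cases j <;> intro a b c
  · exact le_refl (A.dia a b c)
  · exact le_refl (A.dia a b c)
  · rfl

theorem isAlgMor_comp {j : Kind} {A B C : Alg.{u}} {g : BoundedLatticeHom B C}
    {f : BoundedLatticeHom A B} (hg : IsAlgMor j g) (hf : IsAlgMor j f) :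
    IsAlgMor j (g.comp f) := by
  cases j <;> intro a b c
  · exact (OrderHomClass.mono g (hf a b c)).trans (hg _ _ _)
  · exact (hg _ _ _).trans (OrderHomClass.mono g (hf a b c))
  · exact (congrArg g (hf a b c)).trans (hg _ _ _)

section MapLemmas

variable {X₁ X₂ X₃ : Type u} [TopologicalSpace X₁] [TopologicalSpace X₂] [TopologicalSpace X₃]
  {R₁ : X₁ → Set X₁ → Set X₁ → Set X₁ → Prop} {R₂ : X₂ → Set X₂ → Set X₂ → Set X₂ → Prop}
  {R₃ : X₃ → Set X₃ → Set X₃ → Set X₃ → Prop}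

theorem isSemiMap_id : IsSemiMap R₁ R₁ id :=
  ⟨fun _ hU => hU, fun _ Z₁ Z₂ Z₃ h => ⟨Z₁, Z₂, Z₃, h, by simp, by simp, by simp⟩⟩

theorem isHemiMap_id : IsHemiMap R₁ R₁ id :=
  ⟨fun _ hU => hU, fun _ Y₁ Y₂ Y₃ h => by simpa using h⟩

theorem isSemiMap_comp {g : X₂ → X₃} {f : X₁ → X₂} (hg : IsSemiMap R₂ R₃ g)
    (hf : IsSemiMap R₁ R₂ f) : IsSemiMap R₁ R₃ (g ∘ f) := by
  refine ⟨fun U hU => hf.1 _ (hg.1 U hU), fun x Z₁ Z₂ Z₃ h => ?_⟩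
  obtain ⟨Y₁, Y₂, Y₃, hY, h₁, h₂, h₃⟩ := hg.2 _ _ _ _ h
  obtain ⟨T₁, T₂, T₃, hT, k₁, k₂, k₃⟩ := hf.2 _ _ _ _ hY
  refine ⟨T₁, T₂, T₃, hT, ?_, ?_, ?_⟩ <;> rw [Set.image_comp]
  · exact (Set.image_mono k₁).trans h₁
  · exact (Set.image_mono k₂).trans h₂
  · exact (Set.image_mono k₃).trans h₃

theorem isHemiMap_comp {g : X₂ → X₃} {f : X₁ → X₂} (hg : IsHemiMap R₂ R₃ g)
    (hf : IsHemiMap R₁ R₂ f) : IsHemiMap R₁ R₃ (g ∘ f) := by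
  refine ⟨fun U hU => hf.1 _ (hg.1 U hU), fun x Y₁ Y₂ Y₃ h => ?_⟩
  rw [Set.image_comp, Set.image_comp, Set.image_comp]
  exact hg.2 _ _ _ _ (hf.2 _ _ _ _ h)

theorem isSpMor_id (j : Kind) : IsSpMor j R₁ R₁ id := by
  cases j
  · exact isSemiMap_id
  · exact isHemiMap_id
  · exact ⟨isSemiMap_id, isHemiMap_id⟩

theorem isSpMor_comp {j : Kind} {g : X₂ → X₃} {f : X₁ → X₂} (hg : IsSpMor j R₂ R₃ g)
    (hf : IsSpMor j R₁ R₂ f) : IsSpMor j R₁ R₃ (g ∘ f) := by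
  cases j
  · exact isSemiMap_comp hg hf
  · exact isHemiMap_comp hg hf
  · exact ⟨isSemiMap_comp hg.1 hf.1, isHemiMap_comp hg.2 hf.2⟩

theorem isSpMor_preservesClopen {j : Kind} {f : X₁ → X₂} (hf : IsSpMor j R₁ R₂ f) :
    PreservesClopen f := by
  cases j
  · exact hf.1
  · exact hf.1
  · exact hf.1.1

end MapLemmas

/-- The category with all PSI-algebras as objects and morphisms of kind `j`. -/
structure AlgCat (j : Kind) where
  alg : Alg.{u}

/-- The category with all PSI-spaces as objects and morphisms of kind `j`. -/
structure SpCat (j : Kind) where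
  space : Space.{u}

/-- Morphisms of kind `j` between PSI-algebras. -/
@[ext]
structure AlgMor (j : Kind) (A B : Alg.{u}) where
  hom : BoundedLatticeHom A B
  isMor : IsAlgMor j hom

/-- Morphisms of kind `j` between PSI-spaces. -/
@[ext]
structure SpMor (j : Kind) (X Y : Space.{u}) where
  map : X → Y
  isMor : IsSpMor j X.rel Y.rel map

instance (j : Kind) : Category.{u} (AlgCat.{u} j) where
  Hom A B := AlgMor j A.alg B.alg
  id A := ⟨BoundedLatticeHom.id A.alg, isAlgMor_id j A.alg⟩
  comp f g := ⟨g.hom.comp f.hom, isAlgMor_comp g.isMor f.isMor⟩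

instance (j : Kind) : Category.{u} (SpCat.{u} j) where
  Hom X Y := SpMor j X.space Y.space
  id _ := ⟨id, isSpMor_id j⟩
  comp f g := ⟨g.map ∘ f.map, isSpMor_comp g.isMor f.isMor⟩

/-! ### From algebras to spaces -/

/-- Ultrafilters of a Boolean algebra. -/
@[ext]
structure Ult (A : Type u) [BooleanAlgebra A] where
  carrier : Set A
  top_mem : ⊤ ∈ carrier
  bot_notMem : ⊥ ∉ carrier
  inf_mem : ∀ a b, a ∈ carrier → b ∈ carrier → a ⊓ b ∈ carrier
  mem_of_le : ∀ a b, a ∈ carrier → a ≤ b → b ∈ carrier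
  mem_or_compl_mem : ∀ a, a ∈ carrier ∨ aᶜ ∈ carrier

/-- The Stone map. -/
def stone {A : Type u} [BooleanAlgebra A] (a : A) : Set (Ult A) := {U | a ∈ U.carrier}

/-- The Stone topology. -/
instance (A : Type u) [BooleanAlgebra A] : TopologicalSpace (Ult A) :=
  generateFrom (Set.range stone)

/-- The filter `F_Y` of a set `Y` of ultrafilters. -/
def filterOf {A : Type u} [BooleanAlgebra A] (Y : Set (Ult A)) : Set A := {a | Y ⊆ stone a}

/-- The relation `R_◇`: `(U, Y) ∈ R_◇` iff `F_{Y₁} × F_{Y₂} × F_{Y₃} ⊆ ◇⁻¹[U]`, for triples of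
nonempty closed sets. -/
def ultRel {A : Type u} [BooleanAlgebra A] (dia : A → A → A → A) (U : Ult A)
    (Y₁ Y₂ Y₃ : Set (Ult A)) : Prop :=
  C0 Y₁ ∧ C0 Y₂ ∧ C0 Y₃ ∧
    ∀ a ∈ filterOf Y₁, ∀ b ∈ filterOf Y₂, ∀ c ∈ filterOf Y₃, dia a b c ∈ U.carrier

/-- The map `h⁻¹` between ultrafilters. -/
def Ult.comap {A B : Type u} [BooleanAlgebra A] [BooleanAlgebra B] (h : BoundedLatticeHom A B)
    (U : Ult B) : Ult A where
  carrier := h ⁻¹' U.carrier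
  top_mem := by simpa using U.top_mem
  bot_notMem := by simpa using U.bot_notMem
  inf_mem a b ha hb := by simpa using U.inf_mem _ _ ha hb
  mem_of_le a b ha hab := U.mem_of_le _ _ ha (OrderHomClass.mono h hab)
  mem_or_compl_mem a := by simpa using U.mem_or_compl_mem (h a)

/-- The assignment `(B, ◇) ↦ (Ult(B), R_◇)`, `h ↦ h⁻¹`, as a functor, given that it is well
defined on objects (`hobj`) and on morphisms (`hmap`). -/
def ultFunctor (j : Kind)
    (hobj : ∀ A : Alg.{u}, IsPSISpace (Ult A) (ultRel A.dia))
    (hmap : ∀ (A B : Alg.{u}) (h : BoundedLatticeHom A B), IsAlgMor j h →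
      IsSpMor j (ultRel B.dia) (ultRel A.dia) (Ult.comap h)) :
    (AlgCat.{u} j)ᵒᵖ ⥤ SpCat.{u} j where
  obj A := ⟨⟨Ult A.unop.alg, ultRel A.unop.alg.dia, hobj A.unop.alg⟩⟩
  map h := ⟨Ult.comap h.unop.hom, hmap _ _ _ h.unop.isMor⟩
  map_id _ := rfl
  map_comp _ _ := rfl

/-! ### From spaces to algebras -/

/-- The operator `◇_R` on the clopen algebra of a PSI-space. -/
def Space.dia (X : Space.{u}) (U₁ U₂ U₃ : Clopens X) : Clopens X :=
  ⟨diaRel X.rel U₁ U₂ U₃, X.isPSI.df1 _ _ _ U₁.isClopen U₂.isClopen U₃.isClopen⟩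

/-- The Boolean homomorphism `U ↦ f⁻¹[U]` between clopen algebras. -/
def clopenComap {X₁ X₂ : Type u} [TopologicalSpace X₁] [TopologicalSpace X₂] (f : X₁ → X₂)
    (hf : PreservesClopen f) : BoundedLatticeHom (Clopens X₂) (Clopens X₁) where
  toFun U := ⟨f ⁻¹' U, hf U U.isClopen⟩
  map_sup' _ _ := rfl
  map_inf' _ _ := rfl
  map_top' := rfl
  map_bot' := rfl

/-- The PSI-algebra of clopen sets of `X`, given that it is one. -/
def clopenAlg (X : Space.{u}) (hX : IsPSIAlgebra (Clopens X) X.dia) : Alg.{u} :=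
  ⟨Clopens X, X.dia, hX⟩

/-- The assignment `(X, R) ↦ (CO(X), ◇_R)`, `f ↦ f⁻¹`, as a functor, given that it is well
defined on objects (`hobj`) and on morphisms (`hmap`). -/
def clopenFunctor (j : Kind)
    (hobj : ∀ X : Space.{u}, IsPSIAlgebra (Clopens X) X.dia)
    (hmap : ∀ (X Y : Space.{u}) (f : X → Y) (hf : IsSpMor j X.rel Y.rel f),
      IsAlgMor (A := clopenAlg Y (hobj Y)) (B := clopenAlg X (hobj X)) j
        (clopenComap f (isSpMor_preservesClopen hf))) :
    SpCat.{u} j ⥤ (AlgCat.{u} j)ᵒᵖ where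
  obj X := op ⟨clopenAlg X.space (hobj X.space)⟩
  map f := Quiver.Hom.op
    ⟨clopenComap f.map (isSpMor_preservesClopen f.isMor), hmap _ _ _ f.isMor⟩
  map_id _ := rfl
  map_comp _ _ := rfl

end PSI

namespace PSI

/-! ### Stone spaces of Boolean algebras -/

section Ultrafilters

variable {A : Type u} [BooleanAlgebra A]

/-! Stone duality takes care of the Boolean algebras and the Boolean spaces, so what remains is that
the operation and the relation determine each other. The link is that, for a clopen triple `U`, a
point `x` lies in `◇_R(U)` exactly when `U` itself belongs to `R(x)`. In an abstract space this is
`IsPSIFrame.mem_diaRel_iff`, because `df2` makes `R(x)` upward closed. In an ultrafilter space it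
appears as `diaRel_stone`: the Stone map carries `◇` to the operation of `R_◇`, with the Stone sets
themselves as witness by monotonicity. Conversely, `df2` says that a closed triple belongs to `R(x)`
iff every clopen triple above it does, and this is the definition of `R_◇` read in the clopen
algebra (`rel_iff_ultRel_clopenNhds`).

The axioms then correspond one by one. Additivity in the first two arguments matches `df3`, through
the compactness argument of `ultRel_exists_left`. The third argument is merely monotone, so the
third coordinate stays a closed set.

For morphisms, the back condition is witnessed by full preimages, using `exists_mem_filterOf_le`,
and the forth condition by direct images. The isomorphisms with the double duals preserve the
structure exactly, so they are morphisms of all three kinds and one argument covers the three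
dualities. -/

theorem Ult.compl_mem_iff (U : Ult A) (a : A) : aᶜ ∈ U.carrier ↔ a ∉ U.carrier := by
  refine ⟨fun h h' => U.bot_notMem ?_, (U.mem_or_compl_mem a).resolve_left⟩
  simpa using U.inf_mem _ _ h' h

theorem Ult.sup_mem_iff (U : Ult A) (a b : A) :
    a ⊔ b ∈ U.carrier ↔ a ∈ U.carrier ∨ b ∈ U.carrier := by
  refine ⟨fun h => ?_, fun h => h.elim (U.mem_of_le _ _ · le_sup_left)
    (U.mem_of_le _ _ · le_sup_right)⟩
  by_contra! hn
  have := U.inf_mem _ _ ((U.compl_mem_iff a).2 hn.1) ((U.compl_mem_iff b).2 hn.2)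
  rw [← compl_sup, U.compl_mem_iff] at this
  exact this h

theorem Ult.inf_mem_iff (U : Ult A) (a b : A) :
    a ⊓ b ∈ U.carrier ↔ a ∈ U.carrier ∧ b ∈ U.carrier :=
  ⟨fun h => ⟨U.mem_of_le _ _ h inf_le_left, U.mem_of_le _ _ h inf_le_right⟩,
    fun h => U.inf_mem _ _ h.1 h.2⟩

theorem stone_mono {a b : A} (h : a ≤ b) : stone a ⊆ stone b := fun U hU => U.mem_of_le _ _ hU h

theorem stone_compl (a : A) : stone aᶜ = (stone a)ᶜ := Set.ext fun U => U.compl_mem_iff a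

theorem stone_sup (a b : A) : stone (a ⊔ b) = stone a ∪ stone b :=
  Set.ext fun U => U.sup_mem_iff a b

theorem stone_inf (a b : A) : stone (a ⊓ b) = stone a ∩ stone b :=
  Set.ext fun U => U.inf_mem_iff a b

theorem stone_top : stone (⊤ : A) = Set.univ := Set.eq_univ_of_forall fun U => U.top_mem

theorem stone_bot : stone (⊥ : A) = ∅ := Set.eq_empty_of_forall_notMem fun U => U.bot_notMem

/-- The ultrafilter theorem: the Stone map reflects the order. -/
theorem le_of_stone_subset {a b : A} (h : stone a ⊆ stone b) : a ≤ b := by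
  by_contra hab
  have hd : Disjoint (Order.PFilter.principal a : Set A) (Order.Ideal.principal b : Set A) :=
    Set.disjoint_left.2 fun x hx hx' => hab
      ((Order.PFilter.mem_principal.1 hx).trans (Order.Ideal.mem_principal.1 hx'))
  obtain ⟨J, hJ, hbJ, haJ⟩ := DistribLattice.prime_ideal_of_disjoint_filter_ideal hd
  let U : Ult A :=
    { carrier := {x | x ∉ J}
      top_mem := hJ.toIsProper.top_notMem
      bot_notMem := fun h => h J.bot_mem
      inf_mem := fun x y hx hy hxy => (hJ.mem_or_mem hxy).elim hx hy
      mem_of_le := fun x y hx hxy hy => hx (J.lower hxy hy)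
      mem_or_compl_mem := fun x => by
        by_contra! hx
        simp only [Set.mem_ofPred_eq, not_not] at hx
        exact hJ.toIsProper.top_notMem (sup_compl_eq_top (x := x) ▸ J.sup_mem hx.1 hx.2) }
  have haU : U ∈ stone a :=
    fun ha => Set.disjoint_left.1 haJ (Order.PFilter.mem_principal.2 le_rfl) ha
  exact h haU (hbJ Order.Ideal.mem_principal_self)

theorem stone_subset_iff {a b : A} : stone a ⊆ stone b ↔ a ≤ b :=
  ⟨le_of_stone_subset, stone_mono⟩

theorem stone_nonempty {a : A} (ha : a ≠ ⊥) : (stone a).Nonempty := by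
  rw [Set.nonempty_iff_ne_empty]
  intro h
  exact ha (le_bot_iff.1 (le_of_stone_subset (h ▸ Set.empty_subset _)))

theorem isOpen_stone (a : A) : IsOpen (stone a) := isOpen_generateFrom_of_mem ⟨a, rfl⟩

theorem isClopen_stone (a : A) : IsClopen (stone a) :=
  ⟨isOpen_compl_iff.1 (stone_compl a ▸ isOpen_stone aᶜ), isOpen_stone a⟩

instance : TotallySeparatedSpace (Ult A) := by
  rw [totallySeparatedSpace_iff_exists_isClopen]
  intro U V hUV
  have : ∃ a, a ∈ U.carrier ∧ a ∉ V.carrier := by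
    by_contra! h
    refine hUV (Ult.ext (Set.Subset.antisymm h fun a ha => ?_))
    by_contra haU
    exact (V.compl_mem_iff a).1 (h _ ((U.compl_mem_iff a).2 haU)) ha
  obtain ⟨a, ha, ha'⟩ := this
  exact ⟨stone a, isClopen_stone a, ha, ha'⟩

/-- An ultrafilter `F` of subsets converges to the point `{a | stone a ∈ F}`, since the subbasic
neighbourhoods of that point lie in `F` by construction. -/
instance : CompactSpace (Ult A) := by
  refine ⟨isCompact_iff_ultrafilter_le_nhds.2 fun F _ => ?_⟩
  let U : Ult A :=
    { carrier := {a | stone a ∈ F}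
      top_mem := by
        rw [Set.mem_ofPred_eq, stone_top]
        exact Filter.univ_mem
      bot_notMem := by simp [stone_bot]
      inf_mem := fun a b ha hb => by
        rw [Set.mem_ofPred_eq, stone_inf]
        exact Filter.inter_mem ha hb
      mem_of_le := fun a b ha hab => Filter.mem_of_superset ha (stone_mono hab)
      mem_or_compl_mem := fun a => by
        simpa [stone_compl, Ultrafilter.compl_mem_iff_notMem] using em (stone a ∈ F) }
  refine ⟨U, trivial, ?_⟩
  rw [nhds_generateFrom]
  refine le_iInf₂ ?_
  rintro _ ⟨hU, a, rfl⟩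
  exact Filter.le_principal_iff.2 hU

theorem isTopologicalBasis_stone : IsTopologicalBasis (Set.range (stone (A := A))) where
  exists_subset_inter := by
    rintro _ ⟨a, rfl⟩ _ ⟨b, rfl⟩ U hU
    exact ⟨_, ⟨a ⊓ b, rfl⟩, stone_inf a b ▸ hU, (stone_inf a b).subset⟩
  sUnion_eq := Set.eq_univ_of_forall fun U => ⟨_, ⟨⊤, rfl⟩, U.top_mem⟩
  eq_generateFrom := rfl

/-- If every member of a set `I` closed under joins fails to cover the compact set `K`, then
some point of `K` avoids `I`. -/
theorem exists_mem_forall_notMem {K : Set (Ult A)} (hK : IsCompact K) {I : Set A}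
    (hbot : ⊥ ∈ I) (hsup : ∀ a ∈ I, ∀ b ∈ I, a ⊔ b ∈ I) (hI : ∀ a ∈ I, ¬ K ⊆ stone a) :
    ∃ y ∈ K, ∀ a ∈ I, a ∉ y.carrier := by
  by_contra! h
  obtain ⟨a, ha, hKa⟩ : ∃ a ∈ I, K ⊆ stone a := by
    refine hK.induction_on (p := fun s => ∃ a ∈ I, s ⊆ stone a) ⟨⊥, hbot, Set.empty_subset _⟩
      ?_ ?_ ?_
    · rintro s t hst ⟨a, ha, hta⟩
      exact ⟨a, ha, hst.trans hta⟩
    · rintro s t ⟨a, ha, hsa⟩ ⟨b, hb, htb⟩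
      exact ⟨a ⊔ b, hsup a ha b hb, stone_sup a b ▸ Set.union_subset_union hsa htb⟩
    · intro y hy
      obtain ⟨a, ha, hay⟩ := h y hy
      exact ⟨stone a, mem_nhdsWithin_of_mem_nhds ((isOpen_stone a).mem_nhds hay), a, ha,
        subset_rfl⟩
  exact hI a ha hKa

/-- The elements whose Stone set lies in `O` are closed under joins, and no point of `K` avoids them
all because Stone sets form a basis. Compactness gives one that covers `K`. -/
theorem exists_stone_between {K O : Set (Ult A)} (hK : IsClosed K) (hO : IsOpen O)
    (hKO : K ⊆ O) : ∃ a, K ⊆ stone a ∧ stone a ⊆ O := by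
  by_contra! h
  obtain ⟨y, hy, hyI⟩ := exists_mem_forall_notMem hK.isCompact (I := {a | stone a ⊆ O})
    (by simp [stone_bot]) (fun a ha b hb => by
      simpa only [Set.mem_ofPred_eq, stone_sup] using Set.union_subset ha hb)
    (fun a ha hKa => h a hKa ha)
  obtain ⟨_, ⟨a, rfl⟩, hya, haO⟩ := isTopologicalBasis_stone.exists_subset_of_mem_open (hKO hy) hO
  exact hyI a haO hya

theorem exists_eq_stone {V : Set (Ult A)} (hV : IsClopen V) : ∃ a, V = stone a := by
  obtain ⟨a, h, h'⟩ := exists_stone_between hV.1 hV.2 subset_rfl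
  exact ⟨a, h.antisymm h'⟩

theorem mem_filterOf {Y : Set (Ult A)} {a : A} : a ∈ filterOf Y ↔ Y ⊆ stone a := Iff.rfl

theorem inf_mem_filterOf {Y : Set (Ult A)} {a b : A} (ha : a ∈ filterOf Y)
    (hb : b ∈ filterOf Y) : a ⊓ b ∈ filterOf Y := by
  rw [mem_filterOf, stone_inf]
  exact Set.subset_inter ha hb

end Ultrafilters

/-! ### The PSI-space of a PSI-algebra -/

section UltSpace

variable {A : Type u} [BooleanAlgebra A] {dia : A → A → A → A}

theorem Is3BAMO.mono (h : Is3BAMO A dia) {a a' b b' c c' : A} (ha : a ≤ a') (hb : b ≤ b')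
    (hc : c ≤ c') : dia a b c ≤ dia a' b' c' := by
  have h₁ := h.sup_left a a' b c
  have h₂ := h.sup_mid a' b b' c
  have h₃ := h.le_sup_right a' b' c c'
  rw [sup_eq_right.2 ha] at h₁
  rw [sup_eq_right.2 hb] at h₂
  rw [sup_eq_right.2 hc] at h₃
  exact ((h₁ ▸ le_sup_left).trans (h₂ ▸ le_sup_left)).trans (le_sup_left.trans h₃)

theorem Is3BAMO.ne_bot (h : Is3BAMO A dia) {U : Ult A} {a b c : A} (hU : dia a b c ∈ U.carrier) :
    a ≠ ⊥ ∧ b ≠ ⊥ ∧ c ≠ ⊥ := by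
  refine ⟨?_, ?_, ?_⟩ <;> rintro rfl <;> refine U.bot_notMem ?_
  · rwa [h.bot_left] at hU
  · rwa [h.bot_mid] at hU
  · rwa [h.bot_right] at hU

theorem not_meets_compl {X : Type u} {Y₁ Y₂ Y₃ U₁ U₂ U₃ : Set X} :
    ¬ Meets Y₁ Y₂ Y₃ U₁ᶜ U₂ᶜ U₃ᶜ ↔ Y₁ ⊆ U₁ ∧ Y₂ ⊆ U₂ ∧ Y₃ ⊆ U₃ := by
  simp only [Meets, not_or, Set.not_nonempty_iff_eq_empty, ← Set.subset_compl_iff_disjoint_right,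
    ← Set.disjoint_iff_inter_eq_empty, compl_compl]

theorem mem_diaRel {X : Type u} {R : X → Set X → Set X → Set X → Prop} {U₁ U₂ U₃ : Set X}
    {x : X} : x ∈ diaRel R U₁ U₂ U₃ ↔
      ∃ Y₁ Y₂ Y₃, R x Y₁ Y₂ Y₃ ∧ Y₁ ⊆ U₁ ∧ Y₂ ⊆ U₂ ∧ Y₃ ⊆ U₃ := by
  simp only [diaRel, Set.mem_ofPred_eq, not_meets_compl]

theorem mem_boxRel_compl {X : Type u} {R : X → Set X → Set X → Set X → Prop} {U₁ U₂ U₃ : Set X}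
    {x : X} : x ∈ boxRel R U₁ᶜ U₂ᶜ U₃ᶜ ↔ x ∉ diaRel R U₁ U₂ U₃ := by
  simp only [diaRel, boxRel, Set.mem_ofPred_eq, not_exists, not_and, not_not]

theorem diaRel_stone (h : Is3BAMO A dia) (a b c : A) :
    diaRel (ultRel dia) (stone a) (stone b) (stone c) = stone (dia a b c) := by
  ext U
  rw [mem_diaRel]
  constructor
  · rintro ⟨Y₁, Y₂, Y₃, hY, h₁, h₂, h₃⟩
    exact hY.2.2.2 a h₁ b h₂ c h₃
  · intro hU
    obtain ⟨ha, hb, hc⟩ := h.ne_bot hU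
    refine ⟨_, _, _, ⟨⟨(isClopen_stone a).1, stone_nonempty ha⟩,
      ⟨(isClopen_stone b).1, stone_nonempty hb⟩, ⟨(isClopen_stone c).1, stone_nonempty hc⟩,
      fun a' ha' b' hb' c' hc' => ?_⟩, subset_rfl, subset_rfl, subset_rfl⟩
    exact U.mem_of_le _ _ hU
      (h.mono (le_of_stone_subset ha') (le_of_stone_subset hb') (le_of_stone_subset hc'))

theorem C0.singleton {X : Type u} [TopologicalSpace X] [T1Space X] (x : X) : C0 ({x} : Set X) :=
  ⟨isClosed_singleton, Set.singleton_nonempty x⟩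

/-- Call `a` bad if `dia a b c ∉ U` for some `b`, `c` in the filters of `Y₂`, `Y₃`. Bad elements are
closed under joins by additivity in the first argument, and none covers `Y₁`; hence some `y ∈ Y₁`
contains no bad element. -/
theorem ultRel_exists_left (h : Is3BAMO A dia) {U : Ult A} {Y₁ Y₂ Y₃ : Set (Ult A)}
    (hY : ultRel dia U Y₁ Y₂ Y₃) : ∃ y ∈ Y₁, ultRel dia U {y} Y₂ Y₃ := by
  obtain ⟨h₁, h₂, h₃, hR⟩ := hY
  obtain ⟨y, hy, hyI⟩ := exists_mem_forall_notMem h₁.1.isCompact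
    (I := {a | ∃ b ∈ filterOf Y₂, ∃ c ∈ filterOf Y₃, dia a b c ∉ U.carrier})
    ⟨⊤, by simp [mem_filterOf, stone_top], ⊤, by simp [mem_filterOf, stone_top],
      by simpa [h.bot_left] using U.bot_notMem⟩
    (by
      rintro a ⟨b, hb, c, hc, ha⟩ a' ⟨b', hb', c', hc', ha'⟩
      refine ⟨b ⊓ b', inf_mem_filterOf hb hb', c ⊓ c', inf_mem_filterOf hc hc', ?_⟩
      rw [h.sup_left, U.sup_mem_iff, not_or]
      exact ⟨fun hm => ha (U.mem_of_le _ _ hm (h.mono le_rfl inf_le_left inf_le_left)),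
        fun hm => ha' (U.mem_of_le _ _ hm (h.mono le_rfl inf_le_right inf_le_right))⟩)
    (by
      rintro a ⟨b, hb, c, hc, ha⟩ hYa
      exact ha (hR a hYa b hb c hc))
  refine ⟨y, hy, C0.singleton y, h₂, h₃, fun a ha b hb c hc => ?_⟩
  by_contra hn
  exact hyI a ⟨b, hb, c, hc, hn⟩ (ha rfl)

theorem ultRel_swap (h : ∀ a b f, dia a b f ≤ dia b a f) {U : Ult A} {Y₁ Y₂ Y₃ : Set (Ult A)}
    (hY : ultRel dia U Y₁ Y₂ Y₃) : ultRel dia U Y₂ Y₁ Y₃ :=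
  ⟨hY.2.1, hY.1, hY.2.2.1, fun a ha b hb c hc =>
    U.mem_of_le _ _ (hY.2.2.2 b hb a ha c hc) (h b a c)⟩

theorem exists_notMem_of_not_ultRel {U : Ult A} {Y₁ Y₂ Y₃ : Set (Ult A)} (h₁ : C0 Y₁)
    (h₂ : C0 Y₂) (h₃ : C0 Y₃) (hn : ¬ ultRel dia U Y₁ Y₂ Y₃) :
    ∃ a ∈ filterOf Y₁, ∃ b ∈ filterOf Y₂, ∃ c ∈ filterOf Y₃, dia a b c ∉ U.carrier := by
  by_contra! h
  exact hn ⟨h₁, h₂, h₃, h⟩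

theorem isPSISpace_ult (h : IsPSIAlgebra A dia) : IsPSISpace (Ult A) (ultRel dia) where
  compact := inferInstance
  hausdorff := inferInstance
  totallyDisconnected := inferInstance
  rel_C0 U Y₁ Y₂ Y₃ hY := ⟨hY.1, hY.2.1, hY.2.2.1⟩
  df1 U₁ U₂ U₃ h₁ h₂ h₃ := by
    obtain ⟨a, rfl⟩ := exists_eq_stone h₁
    obtain ⟨b, rfl⟩ := exists_eq_stone h₂
    obtain ⟨c, rfl⟩ := exists_eq_stone h₃
    rw [diaRel_stone h.toIs3BAMO]
    exact isClopen_stone _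
  df2 U Y₁ Y₂ Y₃ h₁ h₂ h₃ := by
    refine ⟨fun hR V₁ V₂ V₃ _ _ _ hU => hU _ _ _ hR, fun hR => ⟨h₁, h₂, h₃, ?_⟩⟩
    intro a ha b hb c hc
    by_contra hn
    have hbox := mem_boxRel_compl.2 fun hm => hn ((diaRel_stone h.toIs3BAMO a b c).subset hm)
    exact not_meets_compl.2 ⟨ha, hb, hc⟩ (hR _ _ _ (isClopen_stone a).compl
      (isClopen_stone b).compl (isClopen_stone c).compl hbox)
  df3 U Y₁ Y₂ Y₃ hY := by
    obtain ⟨y₁, hy₁, hY⟩ := ultRel_exists_left h.toIs3BAMO hY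
    -- The symmetry `pi4` reduces the second coordinate to the first.
    obtain ⟨y₂, hy₂, hY⟩ := ultRel_exists_left h.toIs3BAMO (ultRel_swap h.pi4 hY)
    exact ⟨y₁, hy₁, y₂, hy₂, ultRel_swap h.pi4 hY⟩
  pif1 Y₁ Y₂ Y₃ Z W h₁ h₂ h₃ hZ hW U hU := by
    by_contra hn
    simp only [Set.mem_union, not_or] at hn
    obtain ⟨⟨hnZ, hnW⟩, hn⟩ := hn
    obtain ⟨a, ha, b, hb, d, hd, hnd⟩ := exists_notMem_of_not_ultRel h₁ h₂ hZ hnZ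
    obtain ⟨a', ha', b', hb', e, he, hne⟩ := exists_notMem_of_not_ultRel h₁ h₂ hW hnW
    -- At the meets `a ⊓ a'` and `b ⊓ b'`, a single instance of `pi1` has both of its first two
    -- terms outside `U`.
    have key : ∀ c ∈ filterOf Y₃, dia dᶜ eᶜ c ∈ U.carrier := by
      intro c hc
      have hm := U.mem_of_le _ _ (hU.2.2.2 (a ⊓ a') (inf_mem_filterOf ha ha') (b ⊓ b')
        (inf_mem_filterOf hb hb') c hc) (h.pi1 _ _ dᶜ eᶜ c)
      rw [U.sup_mem_iff, U.sup_mem_iff, compl_compl, compl_compl] at hm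
      refine hm.resolve_left (not_or.2 ⟨fun hm => hnd ?_, fun hm => hne ?_⟩)
      · exact U.mem_of_le _ _ hm (h.mono inf_le_left inf_le_left le_rfl)
      · exact U.mem_of_le _ _ hm (h.mono inf_le_right inf_le_right le_rfl)
    have hdZ : stone dᶜ ⊆ closure Zᶜ :=
      (stone_compl d ▸ Set.compl_subset_compl.2 hd).trans subset_closure
    have heW : stone eᶜ ⊆ closure Wᶜ :=
      (stone_compl e ▸ Set.compl_subset_compl.2 he).trans subset_closure
    -- Normality makes `dᶜ` and `eᶜ` nonzero, hence both closures nonempty.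
    have hne' := h.ne_bot (key ⊤ (by simp [mem_filterOf, stone_top]))
    refine hn ⟨⟨isClosed_closure, (stone_nonempty hne'.1).mono hdZ⟩,
      ⟨isClosed_closure, (stone_nonempty hne'.2.1).mono heW⟩, h₃, fun p hp q hq c hc => ?_⟩
    exact U.mem_of_le _ _ (key c hc) (h.mono (le_of_stone_subset (hdZ.trans hp))
      (le_of_stone_subset (heW.trans hq)) le_rfl)
  pif2 Y₁ Y₂ Y₃ h₁ h₂ h₃ hd := by
    refine Set.eq_empty_of_forall_notMem fun U hU => ?_
    obtain ⟨a, ha, ha'⟩ := exists_stone_between h₁.1 h₃.1.isOpen_compl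
      (Set.disjoint_iff_inter_eq_empty.2 hd).subset_compl_right
    have hc : aᶜ ∈ filterOf Y₃ := by
      rw [mem_filterOf, stone_compl]
      exact Set.subset_compl_comm.1 ha'
    have := hU.2.2.2 a ha ⊤ (by simp [mem_filterOf, stone_top]) _ hc
    rw [h.pi2] at this
    exact U.bot_notMem this
  pif3 Y₁ Y₂ h₁ h₂ U hU := by
    refine ⟨h₁, h₁, h₂, fun a ha b hb c hc => ?_⟩
    exact U.mem_of_le _ _ (U.inf_mem _ _ (U.inf_mem _ _ (ha hU.1) (hb hU.1)) (hc hU.2))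
      ((h.pi3 _ _).trans (h.mono inf_le_left inf_le_right le_rfl))
  pif4 Y₁ Y₂ Y₃ _ _ _ U hU := ultRel_swap h.pi4 hU

end UltSpace

/-! ### Dual maps of homomorphisms -/

section UltMaps

variable {A B : Type u} [BooleanAlgebra A] [BooleanAlgebra B]

theorem continuous_comap (h : BoundedLatticeHom A B) : Continuous (Ult.comap h) :=
  continuous_generateFrom_iff.2 (by rintro _ ⟨a, rfl⟩; exact isOpen_stone (h a))

theorem preservesClopen_comap (h : BoundedLatticeHom A B) : PreservesClopen (Ult.comap h) :=
  fun _ hU => hU.preimage (continuous_comap h)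

/-- The image of the complement of `stone b` is compact, hence closed, and misses `Z`; a Stone set
separating the two provides `a`. -/
theorem exists_mem_filterOf_le (h : BoundedLatticeHom A B) {Z : Set (Ult A)} (hZ : IsClosed Z)
    {b : B} (hb : b ∈ filterOf (Ult.comap h ⁻¹' Z)) : ∃ a ∈ filterOf Z, h a ≤ b := by
  have hK : IsClosed (Ult.comap h '' (stone b)ᶜ) :=
    ((isClopen_stone b).compl.1.isCompact.image (continuous_comap h)).isClosed
  obtain ⟨a, ha, ha'⟩ := exists_stone_between hZ hK.isOpen_compl (by
    rintro z hz ⟨y, hy, rfl⟩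
    exact hy (hb hz))
  refine ⟨a, ha, le_of_stone_subset fun y hy => ?_⟩
  by_contra hyb
  exact ha' hy ⟨y, hyb, rfl⟩

variable {dA : A → A → A → A} {dB : B → B → B → B}

/-- The witness is the triple of full preimages of the `Zᵢ`, the largest one possible. -/
theorem back_comap (hdB : Is3BAMO B dB) (h : BoundedLatticeHom A B)
    (hh : ∀ a b c, h (dA a b c) ≤ dB (h a) (h b) (h c)) :
    Back (ultRel dB) (ultRel dA) (Ult.comap h) := by
  rintro U Z₁ Z₂ Z₃ ⟨h₁, h₂, h₃, hR⟩
  have key : ∀ a ∈ filterOf (Ult.comap h ⁻¹' Z₁), ∀ b ∈ filterOf (Ult.comap h ⁻¹' Z₂),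
      ∀ c ∈ filterOf (Ult.comap h ⁻¹' Z₃), dB a b c ∈ U.carrier := by
    intro a ha b hb c hc
    obtain ⟨a', ha', haa⟩ := exists_mem_filterOf_le h h₁.1 ha
    obtain ⟨b', hb', hbb⟩ := exists_mem_filterOf_le h h₂.1 hb
    obtain ⟨c', hc', hcc⟩ := exists_mem_filterOf_le h h₃.1 hc
    exact U.mem_of_le _ _ (hR a' ha' b' hb' c' hc') ((hh _ _ _).trans (hdB.mono haa hbb hcc))
  have htop : ∀ Y : Set (Ult B), ⊤ ∈ filterOf Y := fun Y => by simp [mem_filterOf, stone_top]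
  -- An empty preimage would have `⊥` in its filter, and then `key` would put a value of `dB` at
  -- `⊥`, which is `⊥`, into `U`.
  have hne : ∀ {Y : Set (Ult B)}, ⊥ ∉ filterOf Y → Y.Nonempty := fun {Y} hY => by
    rw [Set.nonempty_iff_ne_empty]
    rintro rfl
    exact hY (Set.empty_subset _)
  refine ⟨_, _, _, ⟨⟨h₁.1.preimage (continuous_comap h), hne fun hb => ?_⟩,
    ⟨h₂.1.preimage (continuous_comap h), hne fun hb => ?_⟩,
    ⟨h₃.1.preimage (continuous_comap h), hne fun hb => ?_⟩, key⟩,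
    Set.image_preimage_subset _ _, Set.image_preimage_subset _ _, Set.image_preimage_subset _ _⟩
  · exact (hdB.ne_bot (key ⊥ hb ⊤ (htop _) ⊤ (htop _))).1 rfl
  · exact (hdB.ne_bot (key ⊤ (htop _) ⊥ hb ⊤ (htop _))).2.1 rfl
  · exact (hdB.ne_bot (key ⊤ (htop _) ⊤ (htop _) ⊥ hb)).2.2 rfl

theorem forth_comap (h : BoundedLatticeHom A B)
    (hh : ∀ a b c, dB (h a) (h b) (h c) ≤ h (dA a b c)) :
    Forth (ultRel dB) (ultRel dA) (Ult.comap h) := by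
  rintro U Y₁ Y₂ Y₃ ⟨h₁, h₂, h₃, hR⟩
  have hC0 : ∀ {Y : Set (Ult B)}, C0 Y → C0 (Ult.comap h '' Y) := fun hY =>
    ⟨(hY.1.isCompact.image (continuous_comap h)).isClosed, hY.2.image _⟩
  refine ⟨hC0 h₁, hC0 h₂, hC0 h₃, fun a ha b hb c hc => ?_⟩
  exact U.mem_of_le _ _ (hR (h a) (Set.image_subset_iff.1 ha) (h b) (Set.image_subset_iff.1 hb)
    (h c) (Set.image_subset_iff.1 hc)) (hh a b c)

end UltMaps

theorem isSpMor_comap {j : Kind} (A B : Alg.{u}) (h : BoundedLatticeHom A B)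
    (hh : IsAlgMor j h) : IsSpMor j (ultRel B.dia) (ultRel A.dia) (Ult.comap h) := by
  have hsemi : IsSemiHom h → IsSemiMap (ultRel B.dia) (ultRel A.dia) (Ult.comap h) := fun hs =>
    ⟨preservesClopen_comap h, back_comap B.isPSI.toIs3BAMO h hs⟩
  have hhemi : IsHemiHom h → IsHemiMap (ultRel B.dia) (ultRel A.dia) (Ult.comap h) := fun hs =>
    ⟨preservesClopen_comap h, forth_comap h hs⟩
  cases j
  · exact hsemi hh
  · exact hhemi hh
  · exact ⟨hsemi fun a b c => (hh a b c).le, hhemi fun a b c => (hh a b c).ge⟩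

/-! ### The PSI-algebra of a PSI-space -/

section ClopenAlgebra

variable {X : Type u} [TopologicalSpace X] {R : X → Set X → Set X → Set X → Prop}

/-- By `df2` membership in `R(x)` is tested by meeting given sets, a condition that survives
enlargement. -/
theorem IsPSIFrame.rel_mono (h : IsPSIFrame X R) {x : X} {Y₁ Y₂ Y₃ Z₁ Z₂ Z₃ : Set X}
    (hY : R x Y₁ Y₂ Y₃) (hZ₁ : IsClosed Z₁) (hZ₂ : IsClosed Z₂) (hZ₃ : IsClosed Z₃)
    (h₁ : Y₁ ⊆ Z₁) (h₂ : Y₂ ⊆ Z₂) (h₃ : Y₃ ⊆ Z₃) : R x Z₁ Z₂ Z₃ := by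
  obtain ⟨k₁, k₂, k₃⟩ := h.rel_C0 _ _ _ _ hY
  refine (h.df2 x Z₁ Z₂ Z₃ ⟨hZ₁, k₁.2.mono h₁⟩ ⟨hZ₂, k₂.2.mono h₂⟩ ⟨hZ₃, k₃.2.mono h₃⟩).2 ?_
  intro U₁ U₂ U₃ _ _ _ hx
  exact (hx _ _ _ hY).imp (·.mono (Set.inter_subset_inter_left _ h₁))
    (Or.imp (·.mono (Set.inter_subset_inter_left _ h₂))
      (·.mono (Set.inter_subset_inter_left _ h₃)))

theorem IsPSIFrame.mem_diaRel_iff (h : IsPSIFrame X R) {x : X} {U₁ U₂ U₃ : Set X}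
    (h₁ : IsClosed U₁) (h₂ : IsClosed U₂) (h₃ : IsClosed U₃) :
    x ∈ diaRel R U₁ U₂ U₃ ↔ R x U₁ U₂ U₃ := by
  rw [mem_diaRel]
  constructor
  · rintro ⟨Y₁, Y₂, Y₃, hY, k₁, k₂, k₃⟩
    exact h.rel_mono hY h₁ h₂ h₃ k₁ k₂ k₃
  · exact fun hR => ⟨_, _, _, hR, subset_rfl, subset_rfl, subset_rfl⟩

/-- The first axiom of PSI-spaces for complements of clopen sets, which may be empty here. -/
theorem IsPSISpace.rel_or_rel_or_rel (h : IsPSISpace X R) {x : X} {Y₁ Y₂ Y₃ D E : Set X}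
    (hD : IsClopen D) (hE : IsClopen E) (hY : R x Y₁ Y₂ Y₃) :
    (R x Y₁ Y₂ Dᶜ ∨ R x Y₁ Y₂ Eᶜ) ∨ R x D E Y₃ := by
  obtain ⟨k₁, k₂, k₃⟩ := h.rel_C0 _ _ _ _ hY
  have pif : ∀ {D' E' : Set X}, IsClopen D' → IsClopen E' → D'ᶜ.Nonempty → E'ᶜ.Nonempty →
      (R x Y₁ Y₂ D'ᶜ ∨ R x Y₁ Y₂ E'ᶜ) ∨ R x D' E' Y₃ := fun {D' E'} hD' hE' hnD hnE => by
    have := h.pif1 Y₁ Y₂ Y₃ D'ᶜ E'ᶜ k₁ k₂ k₃ ⟨hD'.compl.1, hnD⟩ ⟨hE'.compl.1, hnE⟩ hY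
    rwa [compl_compl, compl_compl, hD'.1.closure_eq, hE'.1.closure_eq] at this
  rcases Dᶜ.eq_empty_or_nonempty with hDe | hDn
  · rw [Set.compl_empty_iff] at hDe
    subst hDe
    rcases Eᶜ.eq_empty_or_nonempty with hEe | hEn
    · rw [Set.compl_empty_iff] at hEe
      subst hEe
      exact .inr (h.rel_mono hY isClosed_univ isClosed_univ k₃.1 (Set.subset_univ _)
        (Set.subset_univ _) subset_rfl)
    -- Only `Eᶜ` is nonempty, so it serves as both `Z` and `W`; the last alternative `R x E E Y₃` is
    -- then enlarged. The mirror case below uses `D` twice.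
    · rcases pif hE hE hEn hEn with (hR | hR) | hR
      · exact .inl (.inr hR)
      · exact .inl (.inr hR)
      · exact .inr (h.rel_mono hR isClosed_univ hE.1 k₃.1 (Set.subset_univ _) subset_rfl
          subset_rfl)
  · rcases Eᶜ.eq_empty_or_nonempty with hEe | hEn
    · rw [Set.compl_empty_iff] at hEe
      subst hEe
      rcases pif hD hD hDn hDn with (hR | hR) | hR
      · exact .inl (.inl hR)
      · exact .inl (.inl hR)
      · exact .inr (h.rel_mono hR hD.1 isClosed_univ k₃.1 subset_rfl (Set.subset_univ _)
          subset_rfl)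
    · exact pif hD hE hDn hEn

end ClopenAlgebra

theorem Space.mem_dia (X : Space.{u}) {U₁ U₂ U₃ : Clopens X} {x : X} :
    x ∈ X.dia U₁ U₂ U₃ ↔ X.rel x U₁ U₂ U₃ :=
  X.isPSI.mem_diaRel_iff U₁.isClosed U₂.isClosed U₃.isClosed

theorem isPSIAlgebra_clopens (X : Space.{u}) : IsPSIAlgebra (Clopens X) X.dia := by
  have hX := X.isPSI
  have hmono : ∀ {a a' b b' c c' : Clopens X}, a ≤ a' → b ≤ b' → c ≤ c' →
      X.dia a b c ≤ X.dia a' b' c' := fun {a a' b b' c c'} ha hb hc x hx =>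
    X.mem_dia.2 (hX.rel_mono (X.mem_dia.1 hx) a'.isClosed b'.isClosed c'.isClosed ha hb hc)
  have hC0 : ∀ {a b c : Clopens X} {x : X}, x ∈ X.dia a b c → C0 (a : Set X) ∧ C0 (b : Set X) ∧
      C0 (c : Set X) := fun hx => hX.rel_C0 _ _ _ _ (X.mem_dia.1 hx)
  refine ⟨⟨?_, ?_, ?_, ?_, ?_, ?_⟩, ?_, ?_, ?_, ?_⟩
  · exact fun b c => le_bot_iff.1 fun x hx => (hC0 hx).1.2.elim fun y hy => hy.elim
  · exact fun b c => le_bot_iff.1 fun x hx => (hC0 hx).2.1.2.elim fun y hy => hy.elim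
  · exact fun b c => le_bot_iff.1 fun x hx => (hC0 hx).2.2.2.elim fun y hy => hy.elim
  · intro a a' b c
    refine le_antisymm (fun x hx => ?_) (sup_le (hmono le_sup_left le_rfl le_rfl)
      (hmono le_sup_right le_rfl le_rfl))
    -- The point supplied by `df3` must lie in one of the two joinands.
    obtain ⟨y₁, hy₁, y₂, hy₂, hR⟩ := hX.df3 _ _ _ _ (X.mem_dia.1 hx)
    rcases hy₁ with hy₁ | hy₁
    · exact .inl (mem_diaRel.2 ⟨_, _, _, hR, Set.singleton_subset_iff.2 hy₁,
        Set.singleton_subset_iff.2 hy₂, subset_rfl⟩)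
    · exact .inr (mem_diaRel.2 ⟨_, _, _, hR, Set.singleton_subset_iff.2 hy₁,
        Set.singleton_subset_iff.2 hy₂, subset_rfl⟩)
  · intro a b b' c
    refine le_antisymm (fun x hx => ?_) (sup_le (hmono le_rfl le_sup_left le_rfl)
      (hmono le_rfl le_sup_right le_rfl))
    obtain ⟨y₁, hy₁, y₂, hy₂, hR⟩ := hX.df3 _ _ _ _ (X.mem_dia.1 hx)
    rcases hy₂ with hy₂ | hy₂
    · exact .inl (mem_diaRel.2 ⟨_, _, _, hR, Set.singleton_subset_iff.2 hy₁,
        Set.singleton_subset_iff.2 hy₂, subset_rfl⟩)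
    · exact .inr (mem_diaRel.2 ⟨_, _, _, hR, Set.singleton_subset_iff.2 hy₁,
        Set.singleton_subset_iff.2 hy₂, subset_rfl⟩)
  · exact fun a b c c' => sup_le (hmono le_rfl le_rfl le_sup_left)
      (hmono le_rfl le_rfl le_sup_right)
  · intro a b d e f x hx
    exact (hX.rel_or_rel_or_rel d.isClopen e.isClopen (X.mem_dia.1 hx)).imp
      (Or.imp X.mem_dia.2 X.mem_dia.2) X.mem_dia.2
  · intro a b
    refine le_bot_iff.1 fun x hx => ?_
    obtain ⟨h₁, h₂, h₃⟩ := hC0 hx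
    have : x ∈ relInv X.rel (a : Set X) b (aᶜ : Clopens X) := X.mem_dia.1 hx
    rw [hX.pif2 _ _ _ h₁ h₂ h₃ (by simp)] at this
    exact this
  · intro a f x hx
    exact X.mem_dia.2 (hX.pif3 a f ⟨a.isClosed, x, hx.1⟩ ⟨f.isClosed, x, hx.2⟩ hx)
  · intro a b f x hx
    obtain ⟨h₁, h₂, h₃⟩ := hC0 hx
    exact X.mem_dia.2 (hX.pif4 _ _ _ h₁ h₂ h₃ (X.mem_dia.1 hx))

theorem isAlgMor_clopenComap {j : Kind} (X Y : Space.{u}) (f : X → Y)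
    (hf : IsSpMor j X.rel Y.rel f) :
    IsAlgMor (A := clopenAlg Y (isPSIAlgebra_clopens Y))
      (B := clopenAlg X (isPSIAlgebra_clopens X)) j
      (clopenComap f (isSpMor_preservesClopen hf)) := by
  have hsemi : Back X.rel Y.rel f → ∀ U₁ U₂ U₃ : Set Y,
      f ⁻¹' diaRel Y.rel U₁ U₂ U₃ ⊆ diaRel X.rel (f ⁻¹' U₁) (f ⁻¹' U₂) (f ⁻¹' U₃) := by
    intro hb U₁ U₂ U₃ x hx
    obtain ⟨Z₁, Z₂, Z₃, hZ, h₁, h₂, h₃⟩ := mem_diaRel.1 hx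
    obtain ⟨Y₁, Y₂, Y₃, hY, k₁, k₂, k₃⟩ := hb _ _ _ _ hZ
    exact mem_diaRel.2 ⟨Y₁, Y₂, Y₃, hY, Set.image_subset_iff.1 (k₁.trans h₁),
      Set.image_subset_iff.1 (k₂.trans h₂), Set.image_subset_iff.1 (k₃.trans h₃)⟩
  have hhemi : Forth X.rel Y.rel f → ∀ U₁ U₂ U₃ : Set Y,
      diaRel X.rel (f ⁻¹' U₁) (f ⁻¹' U₂) (f ⁻¹' U₃) ⊆ f ⁻¹' diaRel Y.rel U₁ U₂ U₃ := by
    intro hb U₁ U₂ U₃ x hx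
    obtain ⟨Y₁, Y₂, Y₃, hY, k₁, k₂, k₃⟩ := mem_diaRel.1 hx
    exact mem_diaRel.2 ⟨_, _, _, hb _ _ _ _ hY, Set.image_subset_iff.2 k₁,
      Set.image_subset_iff.2 k₂, Set.image_subset_iff.2 k₃⟩
  cases j
  · exact fun (U₁ U₂ U₃ : Clopens Y) => hsemi hf.2 U₁ U₂ U₃
  · exact fun (U₁ U₂ U₃ : Clopens Y) => hhemi hf.2 U₁ U₂ U₃
  · exact fun (U₁ U₂ U₃ : Clopens Y) => Clopens.ext
      ((hsemi hf.1.2 U₁ U₂ U₃).antisymm (hhemi hf.2.2 U₁ U₂ U₃))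

/-! ### The unit -/

theorem IsPSIHom.isAlgMor {A B : Alg.{u}} {h : BoundedLatticeHom A B} (hh : IsPSIHom h)
    (j : Kind) : IsAlgMor j h := by
  cases j
  · exact fun a b c => (hh a b c).le
  · exact fun a b c => (hh a b c).ge
  · exact hh

/-- The Stone map as an isomorphism onto the clopen algebra. -/
noncomputable def stoneIso (A : Type u) [BooleanAlgebra A] : A ≃o Clopens (Ult A) :=
  RelIso.ofSurjective
    (OrderEmbedding.ofMapLEIff (fun a => (⟨stone a, isClopen_stone a⟩ : Clopens (Ult A)))
      fun _ _ => stone_subset_iff)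
    fun V => (exists_eq_stone V.isClopen).imp fun _ ha => Clopens.ext ha.symm

/-- The space of ultrafilters of a PSI-algebra. -/
def Alg.ultSpace (A : Alg.{u}) : Space.{u} := ⟨Ult A, ultRel A.dia, isPSISpace_ult A.isPSI⟩

/-- The double dual of a PSI-algebra. -/
def Alg.bidual (A : Alg.{u}) : Alg.{u} := clopenAlg A.ultSpace (isPSIAlgebra_clopens _)

theorem stoneIso_dia (A : Alg.{u}) (a b c : A) :
    stoneIso A (A.dia a b c) =
      A.ultSpace.dia (stoneIso A a) (stoneIso A b) (stoneIso A c) :=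
  Clopens.ext (diaRel_stone A.isPSI.toIs3BAMO a b c).symm

/-- The Stone map as a morphism of kind `j`. -/
noncomputable def stoneMor (j : Kind) (A : Alg.{u}) : AlgMor j A A.bidual where
  hom := (stoneIso A : BoundedLatticeHom A (Clopens (Ult A)))
  isMor := IsPSIHom.isAlgMor (B := A.bidual)
    (h := (stoneIso A : BoundedLatticeHom A (Clopens (Ult A)))) (stoneIso_dia A) j

/-- The inverse of the Stone map as a morphism of kind `j`. -/
noncomputable def stoneInvMor (j : Kind) (A : Alg.{u}) : AlgMor j A.bidual A where
  hom := ((stoneIso A).symm : BoundedLatticeHom (Clopens (Ult A)) A)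
  isMor := IsPSIHom.isAlgMor (A := A.bidual) (fun U V W => by
    refine (stoneIso A).injective ?_
    refine Eq.trans ?_ (stoneIso_dia A _ _ _).symm
    exact ((stoneIso A).apply_symm_apply _).trans (by
      congr 1 <;> exact ((stoneIso A).apply_symm_apply _).symm)) j

/-- The Stone map as an isomorphism of PSI-algebras. -/
noncomputable def stoneCatIso (j : Kind) (A : Alg.{u}) :
    (⟨A⟩ : AlgCat.{u} j) ≅ ⟨A.bidual⟩ where
  hom := stoneMor j A
  inv := stoneInvMor j A
  hom_inv_id := AlgMor.ext (DFunLike.ext _ _ fun a => (stoneIso A).symm_apply_apply a)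
  inv_hom_id := AlgMor.ext (DFunLike.ext _ _ fun U => (stoneIso A).apply_symm_apply U)

/-! ### The counit -/

section Points

variable {X : Type u} [TopologicalSpace X]

/-- The ultrafilter of clopen neighbourhoods of a point. -/
def clopenNhds (x : X) : Ult (Clopens X) where
  carrier := {U | x ∈ U}
  top_mem := trivial
  bot_notMem := id
  inf_mem _ _ ha hb := ⟨ha, hb⟩
  mem_of_le _ _ ha hab := hab ha
  mem_or_compl_mem U := em (x ∈ U)

theorem continuous_clopenNhds : Continuous (clopenNhds (X := X)) :=
  continuous_generateFrom_iff.2 (by rintro _ ⟨U, rfl⟩; exact U.isOpen)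

variable [CompactSpace X]

/-- If `F` came from no point, the clopen sets outside `F` would cover `X`; by compactness and
primeness of `F`, the whole space would be outside `F`. -/
theorem clopenNhds_surjective : Function.Surjective (clopenNhds (X := X)) := by
  intro F
  -- Inclusion between ultrafilters is already equality.
  have hle : ∀ {x : X}, (∀ U ∈ F.carrier, x ∈ U) → clopenNhds x = F := fun {x} hx => by
    refine Ult.ext (Set.Subset.antisymm (fun U hU => ?_) hx)
    by_contra hn
    exact hx _ ((F.compl_mem_iff U).2 hn) hU
  by_contra! hF
  have hcov : ∀ x : X, ∃ U ∉ F.carrier, x ∈ U := by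
    intro x
    by_contra! h
    refine hF x (hle fun U hU => ?_)
    by_contra hxU
    exact h Uᶜ (fun hc => (F.compl_mem_iff U).1 hc hU) hxU
  obtain ⟨U, hU, hUu⟩ : ∃ U ∉ F.carrier, (Set.univ : Set X) ⊆ U := by
    refine isCompact_univ.induction_on (p := fun s => ∃ U ∉ F.carrier, s ⊆ (U : Set X))
      ⟨⊥, F.bot_notMem, Set.empty_subset _⟩ ?_ ?_ ?_
    · rintro s t hst ⟨U, hU, htU⟩
      exact ⟨U, hU, hst.trans htU⟩
    · rintro s t ⟨U, hU, hsU⟩ ⟨V, hV, htV⟩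
      exact ⟨U ⊔ V, fun h => ((F.sup_mem_iff U V).1 h).elim hU hV,
        Set.union_subset_union hsU htV⟩
    · intro x _
      obtain ⟨U, hU, hxU⟩ := hcov x
      exact ⟨U, mem_nhdsWithin_of_mem_nhds (U.isOpen.mem_nhds hxU), U, hU, subset_rfl⟩
  exact hU (top_le_iff.1 (show (⊤ : Clopens X) ≤ U from hUu) ▸ F.top_mem)

variable [T2Space X] [TotallyDisconnectedSpace X]

theorem clopenNhds_injective : Function.Injective (clopenNhds (X := X)) := by
  intro x y hxy
  by_contra hne
  obtain ⟨U, hU, hx, hy⟩ := exists_isClopen_of_totally_separated hne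
  have : (⟨U, hU⟩ : Clopens X) ∈ (clopenNhds y).carrier := hxy ▸ hx
  exact hy this

/-- A Boolean space is homeomorphic to the Stone space of its clopen algebra. -/
noncomputable def clopenNhdsHomeo (X : Type u) [TopologicalSpace X] [CompactSpace X] [T2Space X]
    [TotallyDisconnectedSpace X] : X ≃ₜ Ult (Clopens X) :=
  Continuous.homeoOfEquivCompactToT2
    (f := Equiv.ofBijective clopenNhds ⟨clopenNhds_injective, clopenNhds_surjective⟩)
    continuous_clopenNhds

end Points

section RelIso

variable {X₁ X₂ : Type u} [TopologicalSpace X₁] [TopologicalSpace X₂]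
  {R₁ : X₁ → Set X₁ → Set X₁ → Set X₁ → Prop} {R₂ : X₂ → Set X₂ → Set X₂ → Set X₂ → Prop}

theorem isSpMor_homeomorph (j : Kind) (e : X₁ ≃ₜ X₂)
    (he : ∀ x Y₁ Y₂ Y₃, R₁ x Y₁ Y₂ Y₃ ↔ R₂ (e x) (e '' Y₁) (e '' Y₂) (e '' Y₃)) :
    IsSpMor j R₁ R₂ e := by
  have hc : PreservesClopen e := fun U hU => hU.preimage e.continuous
  have hb : Back R₁ R₂ e := fun x Z₁ Z₂ Z₃ hZ => by
    refine ⟨e ⁻¹' Z₁, e ⁻¹' Z₂, e ⁻¹' Z₃, (he _ _ _ _).2 ?_, Set.image_preimage_subset _ _,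
      Set.image_preimage_subset _ _, Set.image_preimage_subset _ _⟩
    simpa only [Set.image_preimage_eq _ e.surjective] using hZ
  have hf : Forth R₁ R₂ e := fun x Y₁ Y₂ Y₃ => (he x Y₁ Y₂ Y₃).1
  cases j
  · exact ⟨hc, hb⟩
  · exact ⟨hc, hf⟩
  · exact ⟨⟨hc, hb⟩, hc, hf⟩

theorem isSpMor_homeomorph_symm (j : Kind) (e : X₁ ≃ₜ X₂)
    (he : ∀ x Y₁ Y₂ Y₃, R₁ x Y₁ Y₂ Y₃ ↔ R₂ (e x) (e '' Y₁) (e '' Y₂) (e '' Y₃)) :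
    IsSpMor j R₂ R₁ e.symm := by
  refine isSpMor_homeomorph j e.symm fun x Y₁ Y₂ Y₃ => ?_
  rw [he]
  simp only [e.apply_symm_apply, e.symm.image_eq_preimage_symm, e.symm_symm,
    Set.image_preimage_eq _ e.surjective]

end RelIso

instance (X : Space.{u}) : CompactSpace X := X.isPSI.compact

instance (X : Space.{u}) : T2Space X := X.isPSI.hausdorff

instance (X : Space.{u}) : TotallyDisconnectedSpace X := X.isPSI.totallyDisconnected

/-- The double dual of a PSI-space. -/
def Space.bidual (X : Space.{u}) : Space.{u} := (clopenAlg X (isPSIAlgebra_clopens X)).ultSpace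

/-- This is where `df2` is indispensable: after complementing, its boxes become the diamonds that
define `R_◇` on the clopen algebra. -/
theorem rel_iff_ultRel_clopenNhds (X : Space.{u}) (x : X) (Y₁ Y₂ Y₃ : Set X) :
    X.rel x Y₁ Y₂ Y₃ ↔ ultRel X.dia (clopenNhdsHomeo X x) (clopenNhdsHomeo X '' Y₁)
      (clopenNhdsHomeo X '' Y₂) (clopenNhdsHomeo X '' Y₃) := by
  have hC0 : ∀ Y : Set X, C0 (clopenNhdsHomeo X '' Y) ↔ C0 Y := fun Y =>
    and_congr (clopenNhdsHomeo X).isClosed_image Set.image_nonempty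
  have hmem : ∀ (Y : Set X) (U : Clopens X),
      U ∈ filterOf (clopenNhdsHomeo X '' Y) ↔ Y ⊆ U := fun Y U => Set.image_subset_iff
  simp only [ultRel, hC0, hmem]
  constructor
  · intro hR
    obtain ⟨h₁, h₂, h₃⟩ := X.isPSI.rel_C0 _ _ _ _ hR
    exact ⟨h₁, h₂, h₃, fun U₁ k₁ U₂ k₂ U₃ k₃ => mem_diaRel.2 ⟨_, _, _, hR, k₁, k₂, k₃⟩⟩
  · rintro ⟨h₁, h₂, h₃, hR⟩
    refine (X.isPSI.df2 x _ _ _ h₁ h₂ h₃).2 fun U₁ U₂ U₃ k₁ k₂ k₃ hx => ?_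
    by_contra hn
    rw [← compl_compl U₁, ← compl_compl U₂, ← compl_compl U₃] at hn hx
    obtain ⟨l₁, l₂, l₃⟩ := not_meets_compl.1 hn
    exact mem_boxRel_compl.1 hx
      (hR ⟨_, k₁.compl⟩ l₁ ⟨_, k₂.compl⟩ l₂ ⟨_, k₃.compl⟩ l₃)

/-- A PSI-space is isomorphic to its double dual. -/
noncomputable def bidualCatIso (j : Kind) (X : Space.{u}) :
    (⟨X.bidual⟩ : SpCat.{u} j) ≅ ⟨X⟩ where
  hom := ⟨(clopenNhdsHomeo X).symm, isSpMor_homeomorph_symm j (clopenNhdsHomeo X)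
    (rel_iff_ultRel_clopenNhds X)⟩
  inv := ⟨clopenNhdsHomeo X, isSpMor_homeomorph j (clopenNhdsHomeo X)
    (rel_iff_ultRel_clopenNhds X)⟩
  hom_inv_id := SpMor.ext (funext fun F => (clopenNhdsHomeo X).apply_symm_apply F)
  inv_hom_id := SpMor.ext (funext fun x => (clopenNhdsHomeo X).symm_apply_apply x)

/-! ### The dual equivalence -/

/-- The functor `(A, ◇) ↦ (Ult A, R_◇)`. -/
abbrev ultF (j : Kind) : (AlgCat.{u} j)ᵒᵖ ⥤ SpCat.{u} j :=
  ultFunctor j (fun A => isPSISpace_ult A.isPSI) isSpMor_comap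

/-- The functor `(X, R) ↦ (CO(X), ◇_R)`. -/
abbrev clopenF (j : Kind) : SpCat.{u} j ⥤ (AlgCat.{u} j)ᵒᵖ :=
  clopenFunctor j isPSIAlgebra_clopens isAlgMor_clopenComap

/-- The Stone maps form a natural isomorphism. -/
noncomputable def unitNatIso (j : Kind) : 𝟭 (AlgCat.{u} j)ᵒᵖ ≅ ultF j ⋙ clopenF j :=
  -- In this direction the components are the Stone maps and not their inverses, so naturality holds
  -- by definition. The counit is handled likewise.
  (NatIso.ofComponents (F := ultF j ⋙ clopenF j) (G := 𝟭 _)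
    (fun A => (stoneCatIso j A.unop.alg).op)
    fun _ => Quiver.Hom.unop_inj (AlgMor.ext (DFunLike.ext _ _ fun _ => rfl))).symm

/-- The double dual isomorphisms form a natural isomorphism. -/
noncomputable def counitNatIso (j : Kind) : clopenF j ⋙ ultF j ≅ 𝟭 (SpCat.{u} j) :=
  (NatIso.ofComponents (F := 𝟭 _) (G := clopenF j ⋙ ultF j)
    (fun X => (bidualCatIso j X.space).symm)
    fun _ => SpMor.ext (funext fun _ => rfl)).symm

end PSI

theorem mainTheorem9 (j : PSI.Kind) :
    ∃ (hG : ∀ A : PSI.Alg.{u}, PSI.IsPSISpace (PSI.Ult A) (PSI.ultRel A.dia))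
      (hG' : ∀ (A B : PSI.Alg.{u}) (h : BoundedLatticeHom A B), PSI.IsAlgMor j h →
        PSI.IsSpMor j (PSI.ultRel B.dia) (PSI.ultRel A.dia) (PSI.Ult.comap h))
      (hH : ∀ X : PSI.Space.{u}, PSI.IsPSIAlgebra (Clopens X) X.dia)
      (hH' : ∀ (X Y : PSI.Space.{u}) (f : X → Y) (hf : PSI.IsSpMor j X.rel Y.rel f),
        PSI.IsAlgMor (A := PSI.clopenAlg Y (hH Y)) (B := PSI.clopenAlg X (hH X)) j
          (PSI.clopenComap f (PSI.isSpMor_preservesClopen hf)))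
      (E : (PSI.AlgCat.{u} j)ᵒᵖ ≌ PSI.SpCat.{u} j),
        E.functor = PSI.ultFunctor j hG hG' ∧ E.inverse = PSI.clopenFunctor j hH hH' :=
  ⟨fun A => PSI.isPSISpace_ult A.isPSI, PSI.isSpMor_comap, PSI.isPSIAlgebra_clopens,
    PSI.isAlgMor_clopenComap,
    -- The triangle identity is obtained by adjusting the unit, which leaves both functors
    -- unchanged.
    CategoryTheory.Equivalence.mk (PSI.ultF j) (PSI.clopenF j) (PSI.unitNatIso j)
      (PSI.counitNatIso j), rfl, rfl⟩
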